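/- **Setting.** A function-oracle Turing machine $M^?$ computes a partial function $f:\mathbb R^k\to\mathbb R$ if for all $\vec x\in\operatorname{dom} f$, all names $\varphi$ of $\vec x$ (rational sequences with $\|\varphi_m-\vec x\|\le 2^{-m}$ for all $m$, maximum norm) and all $p\in\mathbb N$, $M^\varphi(p)$ halts with a rational $y$ such that $|y-f(\vec x)|\le 2^{-p}$. A formula $F=\mathcal L_0\cup\mathcal N$ in separated linear form over variables $x_1,\dots,x_n$ consists of a finite set $\mathcal L_0$ of linear clauses (disjunctions of $q+c_1x_1+\dots+c_nx_n\diamond 0$ with rational coefficients) and a finite set $\mathcal N$ of non-linear constraints $P: f(x_{i_1},\dots,x_{i_k})\diamond 0$ with $\diamond\in\{>,\ge\}$, where $f$ is a partial computable function with a fixed machine $M_f^?$ computing it. Let $B_i\subseteq\mathbb R$ be the set defined by the clauses of $\mathcal L_0$ that are univariate in $x_i$. $F$ is a *bounded instance* if $\prod_i B_i$ is bounded and $\overline{D_P}\subseteq\operatorname{dom} f$ for all $P\in\mathcal N$, where $D_P=\prod_j B_{i_j}$. A *linearisation* of $P$ at a partial rational assignment $\alpha$ with $[\![P]\!]^\alpha=\mathrm{False}$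 is a linear clause $C$ with $[\![C]\!]^\alpha=\mathrm{False}$ such that $[\![P]\!]^\beta=\mathrm{True}$ implies $[\![C]\!]^\beta=\mathrm{True}$ for all $\beta$. It is *$\epsilon$-full* if $[\![C]\!]^\beta=\mathrm{False}$ for all assignments $\beta$ of the variables $\vec x$ of $P$ with $[\![\vec x]\!]^\beta\in B([\![\vec x]\!]^\alpha,\epsilon)$. A run is $\epsilon$-full if all but finitely many of its linearisations are $\epsilon$-full. The non-final states of $\delta$-ksmt are triples $(\alpha,\mathcal L,\mathcal N)$, where $\alpha$ is a sequence of assignments $z\mapsto q\in\mathbb Q$. The transitions are the following. - $(A)$: if $[\![\mathcal L]\!]^\alpha\ne\mathrm{False}$, append $z\mapsto q$ to $\alpha$ for an unassigned $z$ with $[\![\mathcal L]\!]^{\alpha::z\mapsto q}\neq\mathrm{False}$. - $(R)$: if $[\![\mathcal L]\!]^\alpha\ne\mathrm{False}$ and $z$ is unassigned with $[\![\mathcal L]\!]^{\alpha::z\mapsto q}=\mathrm{False}$ for all $q\in\mathbb Q$, add to $\mathcal L$ a finite set of clauses not containing $z$ that are implied by $\mathcal L$, the set evaluating to False under $\alpha$.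 - $(B)$: if $[\![\mathcal L]\!]^\alpha=\mathrm{False}$, replace $\alpha$ by its maximal prefix $\gamma$ with $[\![\mathcal L]\!]^\gamma\ne\mathrm{False}$. - $(L)$: if $[\![\mathcal L]\!]^\alpha\ne\mathrm{False}$, add to $\mathcal L$ a linearisation at $\alpha$ of some $P\in\mathcal N$ with $[\![P]\!]^\alpha=\mathrm{False}$. - Final SAT: if $\alpha$ is total, $[\![\mathcal L]\!]^\alpha=\mathrm{True}$ and none of $(A),(R),(B),(L)$ applies. - Final UNSAT: if $[\![\mathcal L]\!]^{\mathrm{nil}}=\mathrm{False}$. - Final $\delta$-SAT: if $\alpha$ is total and $[\![\mathcal L\wedge\mathcal N_\delta]\!]^\alpha=\mathrm{True}$, where $(f\diamond0)_\delta$ is $f+\delta\diamond 0$. A run is a finite or infinite sequence of transitions. Fix $\delta\in\mathbb Q_{>0}$ and $p\in\mathbb N$ with $p\ge-\lfloor\log_2\min\{1,\delta/4\}\rfloor$, and a rounding operation $\lfloor\cdot\rceil:\mathbb Q^k\to\mathbb Z^k$ (for each $k$) with $\|\lfloor\vec q\rceil-\vec q\|\le\frac12$. For $P:f(\vec x)\diamond0$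 and an assignment $\alpha$ of $\vec x$, the algorithm $\mathrm{LineariseLocal}_\delta$ runs $M_f^\varphi(p+2)$ with $\varphi_m=\lfloor[\![\vec x]\!]^\alpha2^{m+1}\rceil/2^{m+1}$; let $\tilde y$ be its output and $k$ the maximum index it queries ($0$ if none). It returns None if $\tilde y\diamond-\delta/2$, and otherwise the clause $\vec x\notin B([\![\vec x]\!]^\alpha,2^{-k})$. On a state $(\alpha,\mathcal L,\mathcal N)$ with $\alpha$ total and $[\![\mathcal L]\!]^\alpha=\mathrm{True}$, $\mathrm{nlinStepLocal}_\delta$ adds to $\mathcal L$ a clause returned for some $P\in\mathcal N$, or goes to $\delta$-SAT if None is returned for every $P\in\mathcal N$. **Theorem.** Let $\delta\in\mathbb Q_{>0}$. For any bounded instance $\mathcal L_0\cup\mathcal N$ (and any $p$ as above) there is $\epsilon>0$ such that, for every rounding operation: 1. Every $\delta$-ksmt run starting in $(\mathrm{nil},\mathcal L_0,\mathcal N)$ in which the applications of $(L)$ and Final $\delta$-SAT are performed according to $\mathrm{nlinStepLocal}_\delta$ is $\epsilon$-full; indeed, all of its linearisations are $\epsilon$-full. 2. Let the radius $2^{-k}$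 in $\mathrm{LineariseLocal}_\delta$ be replaced by $2^{-(k+1)}$. Then every sequence of steps from $(\mathrm{nil},\mathcal L_0,\mathcal N)$ that applies the rules $(A),(R),(B)$, Final SAT and Final UNSAT of $\delta$-ksmt and, in the place of $(L)$ and Final $\delta$-SAT, $\mathrm{nlinStepLocal}_\delta$ (whose results are not required in advance to be legal transitions) is a $\delta$-ksmt run, and it is $\epsilon$-full, with all of its linearisations $\epsilon$-full. -/

import Mathlib

/-! ## Function-oracle Turing machines and computable real functions -/

/-- Symbols in which numbers are written on the tapes. -/
inductive OSym where
  | zero | one | minus | slash | comma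
  deriving DecidableEq

/-- Binary digits of a natural number (least significant first). -/
def encodeNatSym (m : ℕ) : List OSym :=
  m.bits.map fun b => if b then OSym.one else OSym.zero

/-- The string `[-]numerator/denominator` of a rational number in lowest terms. -/
def encodeRat (q : ℚ) : List OSym :=
  (if q < 0 then [OSym.minus] else []) ++ encodeNatSym q.num.natAbs ++
    OSym.slash :: encodeNatSym q.den

/-- A rational vector is written as the list of its entries, each followed by a comma. -/
def encodeRatVec {k : ℕ} (v : Fin k → ℚ) : List OSym :=
  (List.ofFn v).flatMap fun q => encodeRat q ++ [OSym.comma]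

/-- Tape symbols: blank (`none`), one of the fixed symbols, or one of finitely many extra ones. -/
abbrev TapeSym (g : ℕ) : Type := Option (OSym ⊕ Fin g)

/-- Writes a string of fixed symbols as tape symbols. -/
def toTapeSyms {g : ℕ} (w : List OSym) : List (TapeSym g) :=
  w.map fun a => some (Sum.inl a)

/-- Head movements. -/
inductive HeadMove where
  | left | stay | right

/-- A two-way infinite tape. `left` lists the cells to the left of the head (nearest first) and
`right` the scanned cell and the cells to its right; all cells not listed are blank. -/
structure OTape (g : ℕ) where
  left : List (TapeSym g)
  right : List (TapeSym g)

namespace OTape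

/-- The scanned symbol. -/
def read {g : ℕ} (T : OTape g) : TapeSym g := T.right.headD none

/-- Write a symbol to the scanned cell, then move the head. -/
def writeMove {g : ℕ} (T : OTape g) (a : TapeSym g) : HeadMove → OTape g
  | HeadMove.stay => ⟨T.left, a :: T.right.tail⟩
  | HeadMove.right => ⟨a :: T.left, T.right.tail⟩
  | HeadMove.left => ⟨T.left.tail, T.left.headD none :: a :: T.right.tail⟩

end OTape

/-- A function-oracle Turing machine with a work tape and a query tape, finitely many states and
finitely many tape symbols. The oracle is not part of the machine. -/
structure OracleTM where
  numStates : ℕ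
  numExtra : ℕ
  start : Fin numStates
  query : Fin numStates
  answer : Fin numStates
  halt : Fin numStates
  trans : Fin numStates → TapeSym numExtra → TapeSym numExtra →
    Fin numStates × (TapeSym numExtra × HeadMove) × (TapeSym numExtra × HeadMove)

namespace OracleTM

/-- A configuration, together with the record of all indices queried so far. -/
structure Cfg (M : OracleTM) where
  state : Fin M.numStates
  work : OTape M.numExtra
  qtape : OTape M.numExtra
  queried : List ℕ

/-- The argument `p` is written on the work tape in unary. -/
def init (M : OracleTM) (p : ℕ) : M.Cfg :=
  ⟨M.start, ⟨[], toTapeSyms (List.replicate p OSym.one)⟩, ⟨[], []⟩, []⟩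

/-- The index on the query tape, in unary: the length of the block of ones that starts at the
head. -/
def queryIndex (M : OracleTM) (c : M.Cfg) : ℕ :=
  (c.qtape.right.takeWhile fun a => a == some (Sum.inl OSym.one)).length

/-- One step with oracle `φ`. The halting state is never left. In the query state, the content of
the query tape (an index `m`) is replaced by the string of `φ m`, and the machine passes to the
answer state. -/
def step (M : OracleTM) {k : ℕ} (φ : ℕ → Fin k → ℚ) (c : M.Cfg) : M.Cfg :=
  if c.state = M.halt then c
  else if c.state = M.query then
    ⟨M.answer, c.work, ⟨[], toTapeSyms (encodeRatVec (φ (M.queryIndex c)))⟩,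
      M.queryIndex c :: c.queried⟩
  else
    let r := M.trans c.state c.work.read c.qtape.read
    ⟨r.1, c.work.writeMove r.2.1.1 r.2.1.2, c.qtape.writeMove r.2.2.1 r.2.2.2, c.queried⟩

/-- `M^φ(p)` halts with output `y` (the string on the work tape from the head up to the first
blank), and `k` is the maximum index it queries (`0` if it asks no query). -/
def HaltsWith (M : OracleTM) {n : ℕ} (φ : ℕ → Fin n → ℚ) (p : ℕ) (y : ℚ) (k : ℕ) : Prop :=
  ∃ t : ℕ, ((M.step φ)^[t] (M.init p)).state = M.halt ∧
    ((M.step φ)^[t] (M.init p)).work.right.takeWhile Option.isSome =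
      toTapeSyms (encodeRat y) ∧
    ((M.step φ)^[t] (M.init p)).queried.foldr max 0 = k

end OracleTM

/-- `φ` is a (Cauchy) name of `x ∈ ℝⁿ`; `‖·‖` on `Fin n → ℝ` is the maximum norm. -/
def IsName {n : ℕ} (φ : ℕ → Fin n → ℚ) (x : Fin n → ℝ) : Prop :=
  ∀ m : ℕ, ‖(fun j => ((φ m j : ℚ) : ℝ)) - x‖ ≤ (2 : ℝ)⁻¹ ^ m

/-- `M` computes the partial function `f : ℝⁿ → ℝ`. -/
def OracleTM.Computes (M : OracleTM) {n : ℕ} (f : (Fin n → ℝ) →. ℝ) : Prop :=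
  ∀ (x : Fin n → ℝ) (y : ℝ), y ∈ f x → ∀ φ : ℕ → Fin n → ℚ, IsName φ x →
    ∀ p : ℕ, ∃ (q : ℚ) (k : ℕ), M.HaltsWith φ p q k ∧ |(q : ℝ) - y| ≤ (2 : ℝ)⁻¹ ^ p

/-! ## Formulas in separated linear form over the variables `x_i`, `i : Fin n` -/

/-- Predicate symbols. -/
inductive PredSym where
  | lt | le | gt | ge | eq | ne

/-- Interpretation of `a ⋄ b` over the reals. -/
def PredSym.Holds : PredSym → ℝ → ℝ → Prop
  | PredSym.lt, a, b => a < b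
  | PredSym.le, a, b => a ≤ b
  | PredSym.gt, a, b => a > b
  | PredSym.ge, a, b => a ≥ b
  | PredSym.eq, a, b => a = b
  | PredSym.ne, a, b => a ≠ b

/-- Partial assignments of rationals to the variables. -/
abbrev PAssign (n : ℕ) : Type := Fin n → Option ℚ

/-- The atomic linear constraint `const + ∑ i, coeff i * x_i ⋄ 0`. -/
structure LinAtom (n : ℕ) where
  const : ℚ
  coeff : Fin n → ℚ
  rel : PredSym

namespace LinAtom

/-- Truth of the atom at a real point. -/
def HoldsAt {n : ℕ} (A : LinAtom n) (v : Fin n → ℝ) : Prop :=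
  A.rel.Holds ((A.const : ℝ) + ∑ i, (A.coeff i : ℝ) * v i) 0

/-- All variables of the atom are assigned. -/
def Assigned {n : ℕ} (A : LinAtom n) (α : PAssign n) : Prop :=
  ∀ i, A.coeff i ≠ 0 → α i ≠ none

/-- The atom evaluates to true under the partial assignment. -/
def IsTrue {n : ℕ} (A : LinAtom n) (α : PAssign n) : Prop :=
  A.Assigned α ∧ A.HoldsAt fun i => (((α i).getD 0 : ℚ) : ℝ)

/-- The atom evaluates to false under the partial assignment. -/
def IsFalse {n : ℕ} (A : LinAtom n) (α : PAssign n) : Prop :=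
  A.Assigned α ∧ ¬ A.HoldsAt fun i => (((α i).getD 0 : ℚ) : ℝ)

end LinAtom

/-- A linear clause: a finite disjunction of atomic linear constraints. -/
abbrev LinClause (n : ℕ) : Type := List (LinAtom n)

namespace LinClause

/-- Truth of the clause at a real point. -/
def HoldsAt {n : ℕ} (C : LinClause n) (v : Fin n → ℝ) : Prop := ∃ A ∈ C, A.HoldsAt v

/-- The clause evaluates to true. -/
def IsTrue {n : ℕ} (C : LinClause n) (α : PAssign n) : Prop := ∃ A ∈ C, A.IsTrue α

/-- The clause evaluates to false. -/
def IsFalse {n : ℕ} (C : LinClause n) (α : PAssign n) : Prop := ∀ A ∈ C, A.IsFalse α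

/-- The variables that occur in the clause. -/
def vars {n : ℕ} (C : LinClause n) : Set (Fin n) := {i | ∃ A ∈ C, A.coeff i ≠ 0}

end LinClause

/-- A set of clauses evaluates to true. -/
def ClausesTrue {n : ℕ} (L : Set (LinClause n)) (α : PAssign n) : Prop := ∀ C ∈ L, C.IsTrue α

/-- A set of clauses evaluates to false. -/
def ClausesFalse {n : ℕ} (L : Set (LinClause n)) (α : PAssign n) : Prop := ∃ C ∈ L, C.IsFalse α

/-- A non-linear constraint `f(x_{i_1}, …, x_{i_k}) ⋄ 0` with a partial computable function
`f : ℝᵏ → ℝ`, and the machine that is used to compute `f`. -/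
structure NonlinConstraint (n : ℕ) where
  arity : ℕ
  vars : Fin arity → Fin n
  f : (Fin arity → ℝ) →. ℝ
  machine : OracleTM
  computes : machine.Computes f
  rel : PredSym

namespace NonlinConstraint

/-- The partial assignment `α` assigns the vector `v` to the variables of `P`. -/
def Values {n : ℕ} (P : NonlinConstraint n) (α : PAssign n) (v : Fin P.arity → ℚ) : Prop :=
  ∀ j, α (P.vars j) = some (v j)

/-- `P` evaluates to true. -/
def IsTrue {n : ℕ} (P : NonlinConstraint n) (α : PAssign n) : Prop :=
  ∃ v, P.Values α v ∧ ∃ y ∈ P.f (fun j => (v j : ℝ)), P.rel.Holds y 0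

/-- `P` evaluates to false. -/
def IsFalse {n : ℕ} (P : NonlinConstraint n) (α : PAssign n) : Prop :=
  ∃ v, P.Values α v ∧ ∃ y ∈ P.f (fun j => (v j : ℝ)), ¬ P.rel.Holds y 0

end NonlinConstraint

/-- The `δ`-weakening of `y ⋄ 0`. -/
def PredSym.WeakHolds (δ : ℝ) : PredSym → ℝ → Prop
  | PredSym.lt, y => y - δ < 0
  | PredSym.le, y => y - δ ≤ 0
  | PredSym.gt, y => y + δ > 0
  | PredSym.ge, y => y + δ ≥ 0
  | PredSym.eq, y => |y| - δ ≤ 0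
  | PredSym.ne, y => y - δ < 0 ∨ y + δ > 0

/-- The `δ`-weakening `P_δ` evaluates to true. -/
def NonlinConstraint.WeakTrue {n : ℕ} (P : NonlinConstraint n) (δ : ℚ) (α : PAssign n) : Prop :=
  ∃ v, P.Values α v ∧ ∃ y ∈ P.f (fun j => (v j : ℝ)), P.rel.WeakHolds (δ : ℝ) y

/-- A formula `L₀ ∪ N` in separated linear form. -/
structure SepFormula (n : ℕ) where
  lin : Finset (LinClause n)
  nonlin : Finset (NonlinConstraint n)

namespace SepFormula

/-- The set `B_i` defined by the linear clauses that are univariate in `x_i`. -/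
def varBound {n : ℕ} (F : SepFormula n) (i : Fin n) : Set ℝ :=
  {x | ∀ C ∈ F.lin, C.vars = {i} → C.HoldsAt fun _ => x}

/-- The domain `D_F`, the product of the `B_i`. -/
def domain {n : ℕ} (F : SepFormula n) : Set (Fin n → ℝ) := {v | ∀ i, v i ∈ F.varBound i}

/-- The domain `D_P` of a non-linear constraint. -/
def constraintDomain {n : ℕ} (F : SepFormula n) (P : NonlinConstraint n) :
    Set (Fin P.arity → ℝ) :=
  {v | ∀ j, v j ∈ F.varBound (P.vars j)}

/-- Bounded instances. -/
def IsBoundedInstance {n : ℕ} (F : SepFormula n) : Prop :=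
  Bornology.IsBounded F.domain ∧ ∀ P ∈ F.nonlin, closure (F.constraintDomain P) ⊆ P.f.Dom

end SepFormula

/-! ## Linearisations -/

/-- `C` is a linearisation of `P` at `α`. -/
def IsLinearisation {n : ℕ} (P : NonlinConstraint n) (α : PAssign n) (C : LinClause n) : Prop :=
  P.IsFalse α ∧ (∀ β : PAssign n, P.IsTrue β → C.IsTrue β) ∧ C.IsFalse α

/-- `C` is an `ε`-full linearisation of `P` at `α`. -/
def IsEpsFullLinearisation {n : ℕ} (ε : ℝ) (P : NonlinConstraint n) (α : PAssign n)
    (C : LinClause n) : Prop :=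
  IsLinearisation P α C ∧
    ∀ (a b : Fin P.arity → ℚ) (β : PAssign n), P.Values α a → P.Values β b →
      (fun j => (b j : ℝ)) ∈ Metric.ball (fun j => (a j : ℝ)) ε → C.IsFalse β

/-! ## The `δ`-ksmt calculus -/

/-- The assignment component of a state: the sequence of decisions, the latest one last. -/
abbrev Trail (n : ℕ) : Type := List (Fin n × ℚ)

/-- The partial assignment given by a trail. -/
def Trail.val {n : ℕ} (α : Trail n) : PAssign n := fun z => List.lookup z α

/-- All variables are assigned. -/
def Trail.IsTotal {n : ℕ} (α : Trail n) : Prop := ∀ z, α.val z ≠ none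

/-- States. The non-linear part never changes in a derivation; it is a parameter of the
transition relations. -/
inductive KState (n : ℕ) where
  | active (α : Trail n) (L : Set (LinClause n))
  | sat
  | unsat
  | deltaSat

/-- The rule applied in a transition. -/
inductive RuleLabel (n : ℕ) where
  | assign (z : Fin n) (q : ℚ)
  | resolve (z : Fin n) (R : Finset (LinClause n))
  | backjump
  | linearise (P : NonlinConstraint n) (C : LinClause n)
  | finalSat
  | finalUnsat
  | finalDeltaSat

/-- `R` is a resolvent on `z`: a set of clauses without `z` that are implied by `L`, and that
evaluates to false under `α`. -/
def IsResolvent {n : ℕ} (α : Trail n) (L : Set (LinClause n)) (z : Fin n)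
    (R : Finset (LinClause n)) : Prop :=
  (∀ C ∈ R, z ∉ C.vars ∧ ∀ v : Fin n → ℝ, (∀ C' ∈ L, C'.HoldsAt v) → C.HoldsAt v) ∧
    ClausesFalse (R : Set (LinClause n)) α.val

/-- The rules `(A)`, `(R)`, `(B)`, `(L)` for the non-linear part `N`. -/
inductive CoreStep {n : ℕ} (N : Finset (NonlinConstraint n)) :
    KState n → RuleLabel n → KState n → Prop
  | assign (α : Trail n) (L : Set (LinClause n)) (z : Fin n) (q : ℚ)
      (hL : ¬ ClausesFalse L α.val) (hz : α.val z = none)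
      (hq : ¬ ClausesFalse L (Trail.val (α ++ [(z, q)]))) :
      CoreStep N (KState.active α L) (RuleLabel.assign z q) (KState.active (α ++ [(z, q)]) L)
  | resolve (α : Trail n) (L : Set (LinClause n)) (z : Fin n) (R : Finset (LinClause n))
      (hL : ¬ ClausesFalse L α.val) (hz : α.val z = none)
      (hq : ∀ q : ℚ, ClausesFalse L (Trail.val (α ++ [(z, q)])))
      (hR : IsResolvent α L z R) :
      CoreStep N (KState.active α L) (RuleLabel.resolve z R)
        (KState.active α (L ∪ (R : Set (LinClause n))))
  | backjump (α γ : Trail n) (L : Set (LinClause n))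
      (hL : ClausesFalse L α.val) (hγ : γ <+: α) (hLγ : ¬ ClausesFalse L γ.val)
      (hmax : ∀ γ' : Trail n, γ' <+: α → ¬ ClausesFalse L γ'.val → γ' <+: γ) :
      CoreStep N (KState.active α L) RuleLabel.backjump (KState.active γ L)
  | linearise (α : Trail n) (L : Set (LinClause n)) (P : NonlinConstraint n) (C : LinClause n)
      (hL : ¬ ClausesFalse L α.val) (hP : P ∈ N) (hPα : P.IsFalse α.val)
      (hC : IsLinearisation P α.val C) :
      CoreStep N (KState.active α L) (RuleLabel.linearise P C) (KState.active α (L ∪ {C}))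

/-- The transitions of `δ`-ksmt. -/
inductive DeltaStep {n : ℕ} (N : Finset (NonlinConstraint n)) (δ : ℚ) :
    KState n → RuleLabel n → KState n → Prop
  | core (S S' : KState n) (r : RuleLabel n) (h : CoreStep N S r S') : DeltaStep N δ S r S'
  | finalSat (α : Trail n) (L : Set (LinClause n)) (hα : α.IsTotal) (hL : ClausesTrue L α.val)
      (hno : ∀ r S', ¬ CoreStep N (KState.active α L) r S') :
      DeltaStep N δ (KState.active α L) RuleLabel.finalSat KState.sat
  | finalUnsat (α : Trail n) (L : Set (LinClause n)) (hL : ClausesFalse L (Trail.val [])) :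
      DeltaStep N δ (KState.active α L) RuleLabel.finalUnsat KState.unsat
  | finalDeltaSat (α : Trail n) (L : Set (LinClause n)) (hα : α.IsTotal)
      (hL : ClausesTrue L α.val) (hN : ∀ P ∈ N, P.WeakTrue δ α.val) :
      DeltaStep N δ (KState.active α L) RuleLabel.finalDeltaSat KState.deltaSat

/-! ## Runs -/

/-- A finite (`len < ⊤`) or infinite (`len = ⊤`) labelled sequence of states; only the entries
`state i` with `i ≤ len` and `label i` with `i < len` are meaningful. -/
structure KRun (n : ℕ) where
  len : ℕ∞
  state : ℕ → KState n
  label : ℕ → RuleLabel n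

namespace KRun

/-- The sequence starts in `S₀` and each of its steps is a transition of `T`. -/
def IsRunOf {n : ℕ} (r : KRun n) (T : KState n → RuleLabel n → KState n → Prop)
    (S₀ : KState n) : Prop :=
  r.state 0 = S₀ ∧ ∀ i : ℕ, (i : ℕ∞) < r.len → T (r.state i) (r.label i) (r.state (i + 1))

/-- Step `i` adds `C` to the clauses, as a linearisation of `P` at `α`. -/
def LinearisesAt {n : ℕ} (r : KRun n) (i : ℕ) (P : NonlinConstraint n) (α : Trail n)
    (C : LinClause n) : Prop :=
  (i : ℕ∞) < r.len ∧ r.label i = RuleLabel.linearise P C ∧ ∃ L, r.state i = KState.active α L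

/-- All but finitely many linearisations of the run are `ε`-full. -/
def IsEpsFull {n : ℕ} (r : KRun n) (ε : ℝ) : Prop :=
  {i : ℕ | ∃ P α C, r.LinearisesAt i P α C ∧ ¬ IsEpsFullLinearisation ε P α.val C}.Finite

/-- All linearisations of the run are `ε`-full. -/
def AllEpsFull {n : ℕ} (r : KRun n) (ε : ℝ) : Prop :=
  ∀ i P α C, r.LinearisesAt i P α C → IsEpsFullLinearisation ε P α.val C

end KRun

/-! ## Local linearisation -/

/-- A family of operations that round rational vectors to integer vectors, with error at most
`1/2` in the maximum norm. -/
def IsRounding (rnd : ∀ k : ℕ, (Fin k → ℚ) → (Fin k → ℤ)) : Prop :=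
  ∀ (k : ℕ) (q : Fin k → ℚ) (j : Fin k), |((rnd k q j : ℤ) : ℚ) - q j| ≤ 1 / 2

/-- `Approx(a, m) = round(a * 2^(m+1)) / 2^(m+1)`. -/
def approxDyadic (rnd : ∀ k : ℕ, (Fin k → ℚ) → (Fin k → ℤ)) {k : ℕ} (a : Fin k → ℚ) (m : ℕ) :
    Fin k → ℚ :=
  fun j => ((rnd k (fun i => a i * 2 ^ (m + 1)) j : ℤ) : ℚ) / 2 ^ (m + 1)

/-- The linear clause `x ∉ B(a, r)` on the variables of `P`: some variable `x_{i_j}` satisfies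
`x_{i_j} ≤ a_j - r` or `x_{i_j} ≥ a_j + r`. -/
def outsideBall {n : ℕ} (P : NonlinConstraint n) (a : Fin P.arity → ℚ) (r : ℚ) : LinClause n :=
  (List.finRange P.arity).flatMap fun j =>
    [⟨-(a j - r), Pi.single (P.vars j) 1, PredSym.le⟩,
      ⟨-(a j + r), Pi.single (P.vars j) 1, PredSym.ge⟩]

/-- `LineariseLocal_δ` on `P` and `α`, with precision `p`, returns the given result (`none`, or a
clause). The machine of `P` is run with argument `p + 2` on the approximations of the point
assigned by `α`; `k` is its maximum query. The ball that is cut out has radius `2^(-(k+e))`. -/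
def LineariseLocal {n : ℕ} (rnd : ∀ k : ℕ, (Fin k → ℚ) → (Fin k → ℤ)) (δ : ℚ) (p e : ℕ)
    (P : NonlinConstraint n) (α : PAssign n) (result : Option (LinClause n)) : Prop :=
  ∃ (a : Fin P.arity → ℚ) (y : ℚ) (k : ℕ), P.Values α a ∧
    P.machine.HaltsWith (approxDyadic rnd a) (p + 2) y k ∧
    ((P.rel.Holds (y : ℝ) (-(δ : ℝ) / 2) ∧ result = none) ∨
      (¬ P.rel.Holds (y : ℝ) (-(δ : ℝ) / 2) ∧
        result = some (outsideBall P a ((2 : ℚ)⁻¹ ^ (k + e)))))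

/-- The possible results of `nlinStepLocal_δ` on a state whose assignment is total and satisfies
the linear part: either the clause returned for a constraint `P` of `N` is added, or, if nothing is
returned for any constraint of `N`, the state `δ`-SAT is reached. The constraints may be visited
in any order. -/
inductive NlinStepLocal {n : ℕ} (N : Finset (NonlinConstraint n))
    (rnd : ∀ k : ℕ, (Fin k → ℚ) → (Fin k → ℤ)) (δ : ℚ) (p e : ℕ) :
    KState n → RuleLabel n → KState n → Prop
  | linearise (α : Trail n) (L : Set (LinClause n)) (P : NonlinConstraint n) (C : LinClause n)
      (hα : α.IsTotal) (hL : ClausesTrue L α.val) (hP : P ∈ N)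
      (hC : LineariseLocal rnd δ p e P α.val (some C)) :
      NlinStepLocal N rnd δ p e (KState.active α L) (RuleLabel.linearise P C)
        (KState.active α (L ∪ {C}))
  | finalDeltaSat (α : Trail n) (L : Set (LinClause n)) (hα : α.IsTotal)
      (hL : ClausesTrue L α.val) (hN : ∀ P ∈ N, LineariseLocal rnd δ p e P α.val none) :
      NlinStepLocal N rnd δ p e (KState.active α L) RuleLabel.finalDeltaSat KState.deltaSat

/-- The rules `(L)` and `Final δ-SAT`. -/
def RuleLabel.IsNonlinear {n : ℕ} : RuleLabel n → Prop
  | RuleLabel.linearise _ _ => True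
  | RuleLabel.finalDeltaSat => True
  | _ => False

/-- Transitions of `δ`-ksmt in which `(L)` and `Final δ-SAT` are applied according to
`nlinStepLocal_δ`. -/
def LocalDeltaStep {n : ℕ} (N : Finset (NonlinConstraint n))
    (rnd : ∀ k : ℕ, (Fin k → ℚ) → (Fin k → ℤ)) (δ : ℚ) (p e : ℕ)
    (S : KState n) (r : RuleLabel n) (S' : KState n) : Prop :=
  DeltaStep N δ S r S' ∧ (r.IsNonlinear → NlinStepLocal N rnd δ p e S r S')

/-- The steps of the procedure itself: `nlinStepLocal_δ` in the place of `(L)` and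
`Final δ-SAT`, with no demand that its result be a legal transition of `δ`-ksmt, and the
transitions of `δ`-ksmt by the other rules. -/
def LocalProcStep {n : ℕ} (N : Finset (NonlinConstraint n))
    (rnd : ∀ k : ℕ, (Fin k → ℚ) → (Fin k → ℤ)) (δ : ℚ) (p e : ℕ)
    (S : KState n) (r : RuleLabel n) (S' : KState n) : Prop :=
  (r.IsNonlinear → NlinStepLocal N rnd δ p e S r S') ∧ (¬ r.IsNonlinear → DeltaStep N δ S r S')

/-- The initial state `(nil, L₀, N)`. -/
def SepFormula.initState {n : ℕ} (F : SepFormula n) : KState n :=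
  KState.active [] (F.lin : Set (LinClause n))

/-!
A halting computation looks at only finitely many oracle values. Let `y` be the output of `M_f` on
the dyadic approximations of `a` and `k` the largest query. As rounding has error at most
`2 ^ (-(m + 2))` at index `m`, the approximations up to index `k` are the beginning of a name of
every point of the ball of radius `2 ^ (-(k + 1))` around `a`, so `y` approximates `f` on the whole
ball. With the precision chosen for the machine, `f ⋄ 0` thus fails on the ball when `y ⋄ -δ/2`
fails, and `f + δ ⋄ 0` holds at `a` when `y ⋄ -δ/2` holds: the clause cutting out the ball is a
linearisation, and `δ`-SAT is reached legally.

The radii stay away from zero because the queries are bounded. A point at which a nonlinear step is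
made satisfies `L₀`, hence lies in a compact part of `dom f`; the dyadic names of the points of a
compact set form a compact subset of `(ℤⁿ)^ℕ` by Tychonoff's theorem, and on this set the largest
query is locally constant.
-/

/-! ## Strings encoding rational numbers -/

theorem mem_encodeNatSym {m : ℕ} {a : OSym} (h : a ∈ encodeNatSym m) :
    a = OSym.zero ∨ a = OSym.one := by
  obtain ⟨b, -, rfl⟩ := List.mem_map.1 h
  cases b <;> simp

theorem encodeNatSym_injective : Function.Injective encodeNatSym := by
  intro a b h
  have hdigit : Function.Injective fun b : Bool => if b then OSym.one else OSym.zero := by decide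
  have hbits : a.bits = b.bits := hdigit.list_map h
  exact Nat.digits.injective 2 (by rw [Nat.digits_two_eq_bits, Nat.digits_two_eq_bits, hbits])

theorem minus_mem_encodeRat {q : ℚ} : OSym.minus ∈ encodeRat q ↔ q < 0 := by
  have hminus (m : ℕ) : OSym.minus ∉ encodeNatSym m := fun h => by simpa using mem_encodeNatSym h
  by_cases hq : q < 0 <;> simp [encodeRat, hq, hminus]

theorem encodeRat_injective : Function.Injective encodeRat := by
  intro a b h
  have hslash (m : ℕ) : OSym.slash ∉ encodeNatSym m := fun h => by simpa using mem_encodeNatSym h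
  have hsign : a < 0 ↔ b < 0 := by rw [← minus_mem_encodeRat, h, minus_mem_encodeRat]
  simp only [encodeRat, hsign, List.append_assoc, List.append_cancel_left_eq,
    List.append_cons_inj_of_notMem (hslash _) (hslash _)] at h
  have hnatAbs : a.num.natAbs = b.num.natAbs := encodeNatSym_injective h.1
  rw [← Rat.num_neg, ← Rat.num_neg] at hsign
  exact Rat.ext (by omega) (encodeNatSym_injective h.2.2)

theorem toTapeSyms_injective {g : ℕ} :
    Function.Injective (toTapeSyms : List OSym → List (TapeSym g)) :=
  List.map_injective_iff.2 fun _ _ h => Sum.inl_injective (Option.some_injective _ h)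

/-! ## Determinism and the use principle -/

theorem iterate_eq_iterate_of_isFixedPt {α : Type*} {f : α → α} {x : α} {s t : ℕ}
    (hs : Function.IsFixedPt f (f^[s] x)) (ht : Function.IsFixedPt f (f^[t] x)) :
    f^[s] x = f^[t] x :=
  calc f^[s] x = f^[t] (f^[s] x) := (hs.iterate t).symm
    _ = f^[s] (f^[t] x) := Function.Commute.iterate_iterate_self f t s x
    _ = f^[t] x := ht.iterate s

theorem exists_isName {n : ℕ} (x : Fin n → ℝ) : ∃ φ : ℕ → Fin n → ℚ, IsName φ x := by
  have hdense : DenseRange fun (v : Fin n → ℚ) (j : Fin n) => (v j : ℝ) :=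
    DenseRange.piMap fun _ => Rat.denseRange_cast
  choose φ hφ using fun m : ℕ => hdense.exists_dist_lt x (ε := 2⁻¹ ^ m) (by positivity)
  exact ⟨φ, fun m => by rw [← dist_eq_norm, dist_comm]; exact (hφ m).le⟩

namespace OracleTM

variable {M : OracleTM} {n : ℕ} {φ ψ : ℕ → Fin n → ℚ} {c : M.Cfg} {p : ℕ} {y y' : ℚ} {k k' : ℕ}

theorem isFixedPt_step (h : c.state = M.halt) : Function.IsFixedPt (M.step φ) c :=
  if_pos h

theorem HaltsWith.unique (h : M.HaltsWith φ p y k) (h' : M.HaltsWith φ p y' k') :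
    y = y' ∧ k = k' := by
  obtain ⟨s, hs, hy, hk⟩ := h
  obtain ⟨t, ht, hy', hk'⟩ := h'
  rw [iterate_eq_iterate_of_isFixedPt (isFixedPt_step hs) (isFixedPt_step ht)] at hy hk
  exact ⟨encodeRat_injective (toTapeSyms_injective (hy.symm.trans hy')), hk.symm.trans hk'⟩

theorem queried_subset_queried_step : c.queried ⊆ (M.step φ c).queried := by
  unfold step
  split_ifs <;> simp

theorem step_congr (h : ∀ m ∈ (M.step φ c).queried, ψ m = φ m) : M.step ψ c = M.step φ c := by
  unfold step at h ⊢
  split_ifs at h ⊢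
  · rfl
  · rw [h _ List.mem_cons_self]
  · rfl

theorem iterate_step_congr (t : ℕ) (h : ∀ m ∈ ((M.step φ)^[t] c).queried, ψ m = φ m) :
    (M.step ψ)^[t] c = (M.step φ)^[t] c := by
  induction t with
  | zero => rfl
  | succ t ih =>
    simp only [Function.iterate_succ_apply'] at h ⊢
    rw [ih fun m hm => h m (queried_subset_queried_step hm), step_congr h]

theorem HaltsWith.congr (h : M.HaltsWith φ p y k) (hψ : ∀ m ≤ k, ψ m = φ m) :
    M.HaltsWith ψ p y k := by
  obtain ⟨t, ht, hy, rfl⟩ := h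
  have hrun : (M.step ψ)^[t] (M.init p) = (M.step φ)^[t] (M.init p) :=
    iterate_step_congr t fun m hm => hψ m (List.le_max_of_le' 0 hm le_rfl)
  exact ⟨t, by rwa [hrun], by rwa [hrun], by rw [hrun]⟩

theorem Computes.abs_sub_le {f : (Fin n → ℝ) →. ℝ} (hM : M.Computes f) {x : Fin n → ℝ} {z : ℝ}
    (hz : z ∈ f x) (h : M.HaltsWith φ p y k)
    (hφ : ∀ m ≤ k, ‖(fun j => ((φ m j : ℚ) : ℝ)) - x‖ ≤ (2 : ℝ)⁻¹ ^ m) :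
    |(y : ℝ) - z| ≤ (2 : ℝ)⁻¹ ^ p := by
  obtain ⟨ψ, hψ⟩ := exists_isName x
  let χ : ℕ → Fin n → ℚ := fun m => if m ≤ k then φ m else ψ m
  have hχ : IsName χ x := fun m => by
    by_cases hm : m ≤ k
    · simpa only [χ, if_pos hm] using hφ m hm
    · simpa only [χ, if_neg hm] using hψ m
  have hχy : M.HaltsWith χ p y k := h.congr fun m hm => if_pos hm
  obtain ⟨q, k', hq, hle⟩ := hM x z hz χ hχ p
  rwa [(hχy.unique hq).1]

end OracleTM

/-! ## Bounded queries on compact sets -/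

section QueryBound

open Filter Topology

variable {n : ℕ}

theorem OracleTM.eventually_forall_query_le {M : OracleTM} {X : Type*} [TopologicalSpace X]
    {φ : X → ℕ → Fin n → ℚ} (hφ : ∀ m, IsLocallyConstant fun x => φ x m) {K : Set X}
    (hK : IsCompact K) {p : ℕ} (hM : ∀ x ∈ K, ∃ y k, M.HaltsWith (φ x) p y k) :
    ∀ᶠ B in atTop, ∀ x ∈ K, ∀ y k, M.HaltsWith (φ x) p y k → k ≤ B := by
  have hlocal : ∀ x ∈ K, ∀ᶠ q : ℕ × X in atTop ×ˢ 𝓝 x,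
      ∀ y k, M.HaltsWith (φ q.2) p y k → k ≤ q.1 := by
    intro x hx
    obtain ⟨y, k, hxk⟩ := hM x hx
    have hnear : ∀ᶠ x' in 𝓝 x, ∀ m ∈ Set.Iic k, φ x' m = φ x m :=
      (eventually_all_finite (Set.finite_Iic k)).2 fun m _ => (hφ m).eventually_eq x
    filter_upwards [(eventually_ge_atTop k).prod_mk hnear] with q ⟨hkB, hq⟩ y' k' h
    exact (h.unique (hxk.congr hq)).2.trans_le hkB
  have huniform : ∀ᶠ q : ℕ × X in atTop ×ˢ 𝓝ˢ K, ∀ y k, M.HaltsWith (φ q.2) p y k → k ≤ q.1 :=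
    hK.mem_prod_nhdsSet_of_forall hlocal
  exact huniform.curry.mono fun _ h => h.self_of_nhdsSet

/-- The sequence of dyadic vectors with numerators `g`. All approximations computed by
`approxDyadic` have this form, and the numerators, unlike arbitrary rational sequences, range over
a compact set when the sequence is a name of a point of a compact set. -/
def dyadicSeq (g : ℕ → Fin n → ℤ) (m : ℕ) : Fin n → ℚ :=
  fun j => (g m j : ℚ) / 2 ^ (m + 1)

/-- The numerators of the dyadic names of points of `K`. -/
def dyadicNames (K : Set (Fin n → ℝ)) : Set (ℕ → Fin n → ℤ) :=
  {g | ∃ x ∈ K, IsName (dyadicSeq g) x}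

theorem isLocallyConstant_dyadicSeq (m : ℕ) :
    IsLocallyConstant fun g : ℕ → Fin n → ℤ => dyadicSeq g m :=
  (IsLocallyConstant.of_discrete fun (v : Fin n → ℤ) (j : Fin n) =>
    (v j : ℚ) / 2 ^ (m + 1)).comp_continuous (continuous_apply m)

theorem isClosed_isName_dyadicSeq :
    IsClosed {q : (Fin n → ℝ) × (ℕ → Fin n → ℤ) | IsName (dyadicSeq q.2) q.1} := by
  simp only [IsName, dyadicSeq, Set.ofPred_forall]
  refine isClosed_iInter fun m => isClosed_le ?_ continuous_const
  push_cast
  have hcast : Continuous (Int.cast : ℤ → ℝ) := continuous_of_discreteTopology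
  fun_prop

theorem IsName.norm_numerator_le {g : ℕ → Fin n → ℤ} {x : Fin n → ℝ} (hg : IsName (dyadicSeq g) x)
    (m : ℕ) : ‖g m‖ ≤ 2 ^ (m + 1) * (1 + ‖x‖) := by
  have hdyadic : ‖fun j => ((dyadicSeq g m j : ℚ) : ℝ)‖ ≤ 1 + ‖x‖ := by
    have hpow : (2 : ℝ)⁻¹ ^ m ≤ 1 := pow_le_one₀ (by norm_num) (by norm_num)
    linarith [norm_le_norm_sub_add (fun j => ((dyadicSeq g m j : ℚ) : ℝ)) x, hg m]
  refine (pi_norm_le_iff_of_nonneg (by positivity)).2 fun j => ?_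
  have hj : ‖(g m j : ℝ) / 2 ^ (m + 1)‖ ≤ 1 + ‖x‖ := by
    simpa [dyadicSeq] using (norm_le_pi_norm _ j).trans hdyadic
  rwa [norm_div, Int.norm_cast_real, norm_pow, Real.norm_two, div_le_iff₀' (by positivity)] at hj

theorem isCompact_dyadicNames {K : Set (Fin n → ℝ)} (hK : IsCompact K) :
    IsCompact (dyadicNames K) := by
  obtain ⟨R, hR⟩ := hK.isBounded.exists_norm_le
  let box : Set (ℕ → Fin n → ℤ) :=
    Set.univ.pi fun m => Metric.closedBall 0 (2 ^ (m + 1) * (1 + R))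
  have hbox : IsCompact box := isCompact_univ_pi fun m => isCompact_closedBall _ _
  convert ((hK.prod hbox).inter_right isClosed_isName_dyadicSeq).image continuous_snd
  ext g
  suffices ∀ x ∈ K, IsName (dyadicSeq g) x → g ∈ box by
    simp only [dyadicNames, Set.mem_ofPred_eq, Set.mem_image, Set.mem_inter_iff, Set.mem_prod,
      Prod.exists, exists_eq_right]
    grind
  intro x hx hg m _
  rw [mem_closedBall_zero_iff]
  refine (hg.norm_numerator_le m).trans ?_
  gcongr
  exact hR x hx

theorem OracleTM.Computes.eventually_forall_query_le {M : OracleTM} {f : (Fin n → ℝ) →. ℝ}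
    (hM : M.Computes f) {K : Set (Fin n → ℝ)} (hK : IsCompact K) (hKf : K ⊆ f.Dom) (p : ℕ) :
    ∀ᶠ B in atTop, ∀ g ∈ dyadicNames K, ∀ y k, M.HaltsWith (dyadicSeq g) p y k → k ≤ B := by
  refine OracleTM.eventually_forall_query_le isLocallyConstant_dyadicSeq
    (isCompact_dyadicNames hK) ?_
  rintro g ⟨x, hx, hg⟩
  obtain ⟨z, hz⟩ := (PFun.mem_dom _ _).1 (hKf hx)
  obtain ⟨y, k, h, -⟩ := hM x z hz _ hg p
  exact ⟨y, k, h⟩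

end QueryBound

/-! ## Approximation by rounding -/

section Rounding

variable {rnd : ∀ k : ℕ, (Fin k → ℚ) → (Fin k → ℤ)} {n : ℕ} {a : Fin n → ℚ}

theorem norm_approxDyadic_sub_le (hrnd : IsRounding rnd) (a : Fin n → ℚ) (m : ℕ) :
    ‖(fun j => ((approxDyadic rnd a m j : ℚ) : ℝ)) - fun j => (a j : ℝ)‖ ≤
      (2 : ℝ)⁻¹ ^ (m + 2) := by
  refine (pi_norm_le_iff_of_nonneg (by positivity)).2 fun j => ?_
  have hj : |approxDyadic rnd a m j - a j| ≤ (2 : ℚ)⁻¹ ^ (m + 2) :=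
    calc |approxDyadic rnd a m j - a j|
      _ = |(rnd n (fun i => a i * 2 ^ (m + 1)) j : ℚ) - a j * 2 ^ (m + 1)| / 2 ^ (m + 1) := by
        rw [← abs_of_pos (by positivity : (0 : ℚ) < 2 ^ (m + 1)), ← abs_div, approxDyadic,
          abs_of_pos (by positivity : (0 : ℚ) < 2 ^ (m + 1)), sub_div,
          mul_div_cancel_right₀ _ (by positivity)]
      _ ≤ 1 / 2 / 2 ^ (m + 1) := by gcongr; exact hrnd n _ j
      _ = (2 : ℚ)⁻¹ ^ (m + 2) := by
        rw [inv_pow, pow_succ' 2 (m + 1), one_div, mul_inv, div_eq_mul_inv]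
  rw [Pi.sub_apply, Real.norm_eq_abs]
  simpa only [Rat.cast_abs, Rat.cast_sub, Rat.cast_pow, Rat.cast_inv, Rat.cast_ofNat] using
    (Rat.cast_le (K := ℝ)).2 hj

theorem norm_approxDyadic_sub_le_of_dist_le (hrnd : IsRounding rnd) {x : Fin n → ℝ} {k m : ℕ}
    (hx : dist x (fun j => (a j : ℝ)) ≤ (2 : ℝ)⁻¹ ^ (k + 1)) (hm : m ≤ k) :
    ‖(fun j => ((approxDyadic rnd a m j : ℚ) : ℝ)) - x‖ ≤ (2 : ℝ)⁻¹ ^ m := by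
  have hround := norm_approxDyadic_sub_le hrnd a m
  have hxm : dist x (fun j => (a j : ℝ)) ≤ (2 : ℝ)⁻¹ ^ (m + 1) :=
    hx.trans (pow_le_pow_of_le_one (by norm_num) (by norm_num) (by omega))
  rw [← dist_eq_norm] at hround ⊢
  have htri := dist_triangle_right (fun j => ((approxDyadic rnd a m j : ℚ) : ℝ)) x
    fun j => (a j : ℝ)
  have hpos : (0 : ℝ) < (2 : ℝ)⁻¹ ^ m := by positivity
  rw [pow_add] at hround hxm
  linarith

theorem isName_approxDyadic (hrnd : IsRounding rnd) (a : Fin n → ℚ) :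
    IsName (approxDyadic rnd a) fun j => (a j : ℝ) := fun _ =>
  norm_approxDyadic_sub_le_of_dist_le hrnd (by rw [dist_self]; positivity) le_rfl

theorem approxDyadic_eq_dyadicSeq (a : Fin n → ℚ) :
    approxDyadic rnd a = dyadicSeq fun m => rnd n fun i => a i * 2 ^ (m + 1) := rfl

theorem OracleTM.Computes.abs_sub_le_of_dist_le {M : OracleTM} {f : (Fin n → ℝ) →. ℝ}
    (hM : M.Computes f) (hrnd : IsRounding rnd) {p k : ℕ} {y : ℚ}
    (h : M.HaltsWith (approxDyadic rnd a) p y k) {x : Fin n → ℝ}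
    (hx : dist x (fun j => (a j : ℝ)) ≤ (2 : ℝ)⁻¹ ^ (k + 1)) {z : ℝ} (hz : z ∈ f x) :
    |(y : ℝ) - z| ≤ (2 : ℝ)⁻¹ ^ p :=
  hM.abs_sub_le hz h fun _ hm => norm_approxDyadic_sub_le_of_dist_le hrnd hx hm

end Rounding

/-! ## The clause `x ∉ B(a, r)` -/

section OutsideBall

variable {n : ℕ} {P : NonlinConstraint n} {α : PAssign n} {C : LinClause n}

theorem LinAtom.holdsAt_single {i : Fin n} {c : ℚ} {s : PredSym} {v : Fin n → ℝ} :
    (LinAtom.mk c (Pi.single i 1) s).HoldsAt v ↔ s.Holds (c + v i) 0 := by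
  have hsum : ∑ j, ((Pi.single i 1 : Fin n → ℚ) j : ℝ) * v j = v i := by
    simp [Pi.single_apply, apply_ite Rat.cast]
  rw [LinAtom.HoldsAt, hsum]

theorem LinClause.isTrue_iff_not_isFalse (hC : ∀ A ∈ C, A.Assigned α) :
    C.IsTrue α ↔ ¬ C.IsFalse α := by
  simp only [IsTrue, IsFalse, LinAtom.IsTrue, LinAtom.IsFalse]
  grind

theorem LinClause.IsTrue.not_isFalse (h : C.IsTrue α) : ¬ C.IsFalse α := by
  obtain ⟨A, hA, htrue⟩ := h
  exact fun hfalse => (hfalse A hA).2 htrue.2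

theorem ClausesTrue.not_clausesFalse {L : Set (LinClause n)} (h : ClausesTrue L α) :
    ¬ ClausesFalse L α :=
  fun ⟨C, hC, hfalse⟩ => (h C hC).not_isFalse hfalse

theorem NonlinConstraint.Values.unique {a b : Fin P.arity → ℚ} (ha : P.Values α a)
    (hb : P.Values α b) : a = b :=
  funext fun j => Option.some_injective _ ((ha j).symm.trans (hb j))

theorem mem_outsideBall {a : Fin P.arity → ℚ} {r : ℚ} {A : LinAtom n} :
    A ∈ outsideBall P a r ↔ ∃ j, A = ⟨-(a j - r), Pi.single (P.vars j) 1, PredSym.le⟩ ∨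
      A = ⟨-(a j + r), Pi.single (P.vars j) 1, PredSym.ge⟩ := by
  simp [outsideBall]

variable {a b : Fin P.arity → ℚ} {r : ℚ}

theorem assigned_of_mem_outsideBall (hb : P.Values α b) {A : LinAtom n}
    (hA : A ∈ outsideBall P a r) : A.Assigned α := by
  intro i hi
  obtain ⟨j, rfl | rfl⟩ := mem_outsideBall.1 hA <;>
    obtain rfl : i = P.vars j := by_contra fun hne => hi (Pi.single_eq_of_ne hne 1) <;>
    simp [hb j]

theorem outsideBall_isFalse_iff (hr : 0 < r) (hb : P.Values α b) :
    (outsideBall P a r).IsFalse α ↔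
      (fun j => (b j : ℝ)) ∈ Metric.ball (fun j => (a j : ℝ)) r := by
  have hatoms : (outsideBall P a r).IsFalse α ↔
      ∀ j, ¬ ((-(a j - r) : ℚ) + b j : ℝ) ≤ 0 ∧ ¬ ((-(a j + r) : ℚ) + b j : ℝ) ≥ 0 := by
    have hfalse : (outsideBall P a r).IsFalse α ↔
        ∀ A ∈ outsideBall P a r, ¬ A.HoldsAt fun i => (((α i).getD 0 : ℚ) : ℝ) :=
      forall₂_congr fun A hA => and_iff_right (assigned_of_mem_outsideBall hb hA)
    simp only [hfalse, mem_outsideBall, forall_exists_index]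
    rw [forall_comm]
    simp only [forall_eq_or_imp, forall_eq, LinAtom.holdsAt_single, hb _, Option.getD_some,
      PredSym.Holds]
  rw [hatoms, Metric.mem_ball, dist_pi_lt_iff (Rat.cast_pos.2 hr)]
  refine forall_congr' fun j => ?_
  rw [Real.dist_eq, abs_lt]
  push_cast
  constructor <;> rintro ⟨hlower, hupper⟩ <;> constructor <;> linarith

theorem outsideBall_isTrue_iff (hr : 0 < r) (hb : P.Values α b) :
    (outsideBall P a r).IsTrue α ↔
      (fun j => (b j : ℝ)) ∉ Metric.ball (fun j => (a j : ℝ)) r := by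
  rw [LinClause.isTrue_iff_not_isFalse fun _ hA => assigned_of_mem_outsideBall hb hA,
    outsideBall_isFalse_iff hr hb]

theorem isLinearisation_outsideBall (hr : 0 < r) (ha : P.Values α a)
    (hdom : (fun j => (a j : ℝ)) ∈ P.f.Dom)
    (hneg : ∀ b ∈ Metric.ball (fun j => (a j : ℝ)) r, ∀ z ∈ P.f b, ¬ P.rel.Holds z 0) :
    IsLinearisation P α (outsideBall P a r) := by
  have hcenter : (fun j => (a j : ℝ)) ∈ Metric.ball (fun j => (a j : ℝ)) r :=
    Metric.mem_ball_self (Rat.cast_pos.2 hr)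
  refine ⟨?_, ?_, (outsideBall_isFalse_iff hr ha).2 hcenter⟩
  · obtain ⟨z, hz⟩ := (PFun.mem_dom _ _).1 hdom
    exact ⟨a, ha, z, hz, hneg _ hcenter z hz⟩
  · rintro β ⟨b, hb, z, hz, hholds⟩
    exact (outsideBall_isTrue_iff hr hb).2 fun hmem => hneg _ hmem z hz hholds

theorem IsLinearisation.isEpsFull_outsideBall {ε : ℝ} (hε : ε ≤ r) (ha : P.Values α a)
    (h : IsLinearisation P α (outsideBall P a r)) :
    IsEpsFullLinearisation ε P α (outsideBall P a r) := by
  refine ⟨h, fun a' b β ha' hb hab => ?_⟩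
  obtain rfl := ha.unique ha'
  have hr : 0 < r := by exact_mod_cast (Metric.pos_of_mem_ball hab).trans_le hε
  exact (outsideBall_isFalse_iff hr hb).2 (Metric.ball_subset_ball hε hab)

end OutsideBall

/-! ## Correctness of local linearisation -/

theorem PredSym.Holds.of_sub_le_sub {s : PredSym} (hs : s = PredSym.gt ∨ s = PredSym.ge)
    {y c y' c' : ℝ} (h : s.Holds y c) (hle : y - c ≤ y' - c') : s.Holds y' c' := by
  rcases hs with rfl | rfl <;> simp only [PredSym.Holds] at h ⊢ <;> linarith

theorem PredSym.weakHolds_iff {s : PredSym} (hs : s = PredSym.gt ∨ s = PredSym.ge) {δ y : ℝ} :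
    s.WeakHolds δ y ↔ s.Holds y (-δ) := by
  rcases hs with rfl | rfl
  · exact neg_lt_iff_pos_add.symm
  · exact neg_le_iff_add_nonneg.symm

theorem inv_pow_le_of_neg_floor_logb_le {b x : ℝ} (hb : 1 < b) (hx : 0 < x) {p : ℕ}
    (hp : -⌊Real.logb b x⌋ ≤ (p : ℤ)) : b⁻¹ ^ p ≤ x := by
  have hfloor : ((-p : ℤ) : ℝ) ≤ Real.logb b x := Int.le_floor.1 (neg_le.1 hp)
  rwa [Real.le_logb_iff_rpow_le hb hx, Real.rpow_intCast, zpow_neg, zpow_natCast,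
    ← inv_pow] at hfloor

theorem two_inv_pow_add_two_le {δ : ℝ} (hδ : 0 < δ) {p : ℕ}
    (hp : -⌊Real.logb 2 (min 1 (δ / 4))⌋ ≤ (p : ℤ)) : (2 : ℝ)⁻¹ ^ (p + 2) ≤ δ / 2 :=
  calc (2 : ℝ)⁻¹ ^ (p + 2) ≤ (2 : ℝ)⁻¹ ^ p :=
        pow_le_pow_of_le_one (by norm_num) (by norm_num) (Nat.le_add_right p 2)
    _ ≤ min 1 (δ / 4) :=
        inv_pow_le_of_neg_floor_logb_le one_lt_two (lt_min one_pos (by positivity)) hp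
    _ ≤ δ / 2 := (min_le_right _ _).trans (by linarith)

section Local

variable {n : ℕ} {P : NonlinConstraint n} {α : PAssign n} {C : LinClause n}
  {rnd : ∀ k : ℕ, (Fin k → ℚ) → (Fin k → ℤ)} {δ : ℚ} {p e : ℕ}

theorem lineariseLocal_some_iff : LineariseLocal rnd δ p e P α (some C) ↔
    ∃ a y k, P.Values α a ∧ P.machine.HaltsWith (approxDyadic rnd a) (p + 2) y k ∧
      ¬ P.rel.Holds y (-δ / 2) ∧ C = outsideBall P a ((2 : ℚ)⁻¹ ^ (k + e)) := by
  simp [LineariseLocal]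

theorem lineariseLocal_none_iff : LineariseLocal rnd δ p e P α none ↔
    ∃ a y k, P.Values α a ∧ P.machine.HaltsWith (approxDyadic rnd a) (p + 2) y k ∧
      P.rel.Holds y (-δ / 2) := by
  simp [LineariseLocal]

theorem LineariseLocal.isLinearisation (hrnd : IsRounding rnd)
    (hrel : P.rel = PredSym.gt ∨ P.rel = PredSym.ge) (hp : (2 : ℝ)⁻¹ ^ (p + 2) ≤ δ / 2)
    (he : 0 < e) (hdom : ∀ a, P.Values α a → (fun j => (a j : ℝ)) ∈ P.f.Dom)
    (h : LineariseLocal rnd δ p e P α (some C)) : IsLinearisation P α C := by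
  obtain ⟨a, y, k, ha, hhalts, hy, rfl⟩ := lineariseLocal_some_iff.1 h
  refine isLinearisation_outsideBall (by positivity) ha (hdom a ha) fun x hx z hz hholds => ?_
  have hradius : dist x (fun j => (a j : ℝ)) ≤ (2 : ℝ)⁻¹ ^ (k + 1) := by
    refine (Metric.mem_ball.1 hx).le.trans ?_
    push_cast
    exact pow_le_pow_of_le_one (by norm_num) (by norm_num) (by omega)
  have hyz := abs_le.1 (P.computes.abs_sub_le_of_dist_le hrnd hhalts hradius hz)
  exact hy (hholds.of_sub_le_sub hrel (by linarith))

theorem LineariseLocal.weakTrue (hrnd : IsRounding rnd)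
    (hrel : P.rel = PredSym.gt ∨ P.rel = PredSym.ge) (hp : (2 : ℝ)⁻¹ ^ (p + 2) ≤ δ / 2)
    (hdom : ∀ a, P.Values α a → (fun j => (a j : ℝ)) ∈ P.f.Dom)
    (h : LineariseLocal rnd δ p e P α none) : P.WeakTrue δ α := by
  obtain ⟨a, y, k, ha, hhalts, hy⟩ := lineariseLocal_none_iff.1 h
  obtain ⟨z, hz⟩ := (PFun.mem_dom _ _).1 (hdom a ha)
  have hyz := abs_le.1 (P.computes.abs_sub_le hz hhalts fun m _ => isName_approxDyadic hrnd a m)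
  exact ⟨a, ha, z, hz, (PredSym.weakHolds_iff hrel).2 (hy.of_sub_le_sub hrel (by linarith))⟩

theorem LineariseLocal.isEpsFullLinearisation {k₀ : ℕ}
    (hk₀ : ∀ a, P.Values α a → ∀ y k,
      P.machine.HaltsWith (approxDyadic rnd a) (p + 2) y k → k + e ≤ k₀)
    (h : LineariseLocal rnd δ p e P α (some C)) (hlin : IsLinearisation P α C) :
    IsEpsFullLinearisation ((2 : ℝ)⁻¹ ^ k₀) P α C := by
  obtain ⟨a, y, k, ha, hhalts, -, rfl⟩ := lineariseLocal_some_iff.1 h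
  refine hlin.isEpsFull_outsideBall ?_ ha
  push_cast
  exact pow_le_pow_of_le_one (by norm_num) (by norm_num) (hk₀ a ha y k hhalts)

end Local

/-! ## Bounded instances -/

namespace SepFormula

variable {n : ℕ} {F : SepFormula n} {P : NonlinConstraint n}

theorem mem_domain_of_clausesTrue {α : PAssign n}
    (h : ClausesTrue (F.lin : Set (LinClause n)) α) :
    (fun i => (((α i).getD 0 : ℚ) : ℝ)) ∈ F.domain := by
  intro i C hC hvars
  obtain ⟨A, hA, -, htrue⟩ := h C hC
  refine ⟨A, hA, ?_⟩
  have hsum : ∑ j, (A.coeff j : ℝ) * (((α i).getD 0 : ℚ) : ℝ) =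
      ∑ j, (A.coeff j : ℝ) * (((α j).getD 0 : ℚ) : ℝ) := by
    refine Finset.sum_congr rfl fun j _ => ?_
    rcases eq_or_ne (A.coeff j) 0 with hj | hj
    · simp only [hj, Rat.cast_zero, zero_mul]
    · obtain rfl : j = i := hvars.subset ⟨A, hA, hj⟩
      rfl
  rwa [LinAtom.HoldsAt, hsum]

theorem IsBoundedInstance.exists_isCompact (hF : F.IsBoundedInstance) (hP : P ∈ F.nonlin) :
    ∃ K : Set (Fin P.arity → ℝ), IsCompact K ∧ K ⊆ P.f.Dom ∧
      ∀ α a, ClausesTrue (F.lin : Set (LinClause n)) α → P.Values α a →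
        (fun j => (a j : ℝ)) ∈ K := by
  have hcont : Continuous fun v : Fin n → ℝ => v ∘ P.vars := by fun_prop
  refine ⟨(fun v => v ∘ P.vars) '' closure F.domain, hF.1.isCompact_closure.image hcont, ?_, ?_⟩
  · have hsub : (fun v => v ∘ P.vars) '' F.domain ⊆ F.constraintDomain P := by
      rintro _ ⟨v, hv, rfl⟩ j
      exact hv (P.vars j)
    exact (image_closure_subset_closure_image hcont).trans
      ((closure_mono hsub).trans (hF.2 P hP))
  · intro α a hα ha
    refine ⟨_, subset_closure (mem_domain_of_clausesTrue hα), funext fun j => ?_⟩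
    simp only [Function.comp_apply, ha j, Option.getD_some]

theorem IsBoundedInstance.mem_dom (hF : F.IsBoundedInstance) (hP : P ∈ F.nonlin) {α : PAssign n}
    (hα : ClausesTrue (F.lin : Set (LinClause n)) α) {a : Fin P.arity → ℚ} (ha : P.Values α a) :
    (fun j => (a j : ℝ)) ∈ P.f.Dom :=
  let ⟨_, _, hKf, hK⟩ := hF.exists_isCompact hP
  hKf (hK α a hα ha)

/-- At every assignment satisfying the linear part of `F`, whatever the rounding, the machines of
the nonlinear constraints query indices at most `B` when run with argument `p`. -/
def QueryBound (F : SepFormula n) (p B : ℕ) : Prop :=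
  ∀ P ∈ F.nonlin, ∀ rnd, IsRounding rnd → ∀ α, ClausesTrue (F.lin : Set (LinClause n)) α →
    ∀ a, P.Values α a → ∀ y k, P.machine.HaltsWith (approxDyadic rnd a) p y k → k ≤ B

theorem IsBoundedInstance.exists_queryBound (hF : F.IsBoundedInstance) (p : ℕ) :
    ∃ B, F.QueryBound p B := by
  refine ((Filter.eventually_all_finset F.nonlin).2 fun P hP => ?_).exists (f := Filter.atTop)
  obtain ⟨K, hKc, hKf, hK⟩ := hF.exists_isCompact hP
  filter_upwards [P.computes.eventually_forall_query_le hKc hKf p] with B hB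
  intro rnd hrnd α hα a ha
  rw [approxDyadic_eq_dyadicSeq]
  exact hB _ ⟨_, hK α a hα ha, isName_approxDyadic hrnd a⟩

end SepFormula

/-! ## Runs -/

/-- A state carries all clauses of `L₀`; final states carry no clauses and satisfy this
vacuously. -/
def KState.Contains {n : ℕ} (L₀ : Set (LinClause n)) : KState n → Prop
  | KState.active _ L => L₀ ⊆ L
  | _ => True

section Runs

variable {n : ℕ} {T T' : KState n → RuleLabel n → KState n → Prop} {S₀ S S' : KState n}
  {l : RuleLabel n} {r : KRun n} {I : KState n → Prop}

theorem DeltaStep.contains {N : Finset (NonlinConstraint n)} {δ : ℚ} {L₀ : Set (LinClause n)}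
    (h : DeltaStep N δ S l S') (hS : S.Contains L₀) : S'.Contains L₀ := by
  rcases h with ⟨_, _, _, _ | _ | _ | _⟩ | _ | _ | _
  case core.assign | core.backjump => exact hS
  case core.resolve | core.linearise => exact hS.trans Set.subset_union_left
  all_goals trivial

theorem KRun.IsRunOf.invariant (hr : r.IsRunOf T S₀) (h₀ : I S₀)
    (hT : ∀ S l S', I S → T S l S' → I S') (i : ℕ) (hi : (i : ℕ∞) ≤ r.len) : I (r.state i) := by
  induction i with
  | zero => rwa [hr.1]
  | succ i ih =>
    have hlt : (i : ℕ∞) < r.len := (Nat.cast_lt.2 i.lt_succ_self).trans_le hi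
    exact hT _ _ _ (ih hlt.le) (hr.2 i hlt)

theorem KRun.IsRunOf.mono_of_invariant (hr : r.IsRunOf T S₀) (h₀ : I S₀)
    (hI : ∀ S l S', I S → T' S l S' → I S') (hT : ∀ S l S', I S → T S l S' → T' S l S') :
    r.IsRunOf T' S₀ :=
  ⟨hr.1, fun i hi => hT _ _ _
    (hr.invariant h₀ (fun S l S' hS h => hI S l S' hS (hT S l S' hS h)) i hi.le) (hr.2 i hi)⟩

theorem KRun.AllEpsFull.isEpsFull {ε : ℝ} (h : r.AllEpsFull ε) : r.IsEpsFull ε :=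
  Set.finite_empty.subset fun i ⟨P, α, C, hlin, hnot⟩ => hnot (h i P α C hlin)

end Runs

section Procedure

variable {n : ℕ} {F : SepFormula n} {rnd : ∀ k : ℕ, (Fin k → ℚ) → (Fin k → ℤ)} {δ : ℚ}
  {p e E B : ℕ} {S S' : KState n} {l : RuleLabel n} {r : KRun n}

theorem LocalProcStep.deltaStep (hF : F.IsBoundedInstance)
    (hrel : ∀ P ∈ F.nonlin, P.rel = PredSym.gt ∨ P.rel = PredSym.ge)
    (hp : (2 : ℝ)⁻¹ ^ (p + 2) ≤ δ / 2) (hrnd : IsRounding rnd) (he : 0 < e)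
    (hS : S.Contains (F.lin : Set (LinClause n)))
    (h : LocalProcStep F.nonlin rnd δ p e S l S') : DeltaStep F.nonlin δ S l S' := by
  by_cases hl : l.IsNonlinear
  swap
  · exact h.2 hl
  cases h.1 hl with
  | linearise α L P C hα hL hP hC =>
    have hlin := hC.isLinearisation hrnd (hrel P hP) hp he fun _ =>
      hF.mem_dom hP fun C hC => hL C (hS hC)
    exact .core _ _ _ (.linearise α L P C hL.not_clausesFalse hP hlin.1 hlin)
  | finalDeltaSat α L hα hL hN =>
    exact .finalDeltaSat α L hα hL fun P hP => (hN P hP).weakTrue hrnd (hrel P hP) hp fun _ =>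
      hF.mem_dom hP fun C hC => hL C (hS hC)

theorem LocalDeltaStep.isEpsFullLinearisation (hB : F.QueryBound (p + 2) B)
    (hrnd : IsRounding rnd) (he : e ≤ E) {α : Trail n} {L : Set (LinClause n)}
    {P : NonlinConstraint n} {C : LinClause n} (hL₀ : (F.lin : Set (LinClause n)) ⊆ L)
    (h : LocalDeltaStep F.nonlin rnd δ p e (.active α L) (.linearise P C) S') :
    IsEpsFullLinearisation ((2 : ℝ)⁻¹ ^ (B + E)) P α.val C := by
  obtain ⟨⟨_, _, _, _ | _ | _ | ⟨_, _, _, _, -, -, -, hlin⟩⟩, hlocal⟩ := h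
  cases hlocal trivial with
  | linearise _ _ _ _ _ hL hP hC =>
    refine hC.isEpsFullLinearisation (fun a ha y k hhalts => ?_) hlin
    have := hB P hP rnd hrnd α.val (fun C hC => hL C (hL₀ hC)) a ha y k hhalts
    omega

theorem KRun.IsRunOf.allEpsFull (hB : F.QueryBound (p + 2) B) (hrnd : IsRounding rnd)
    (he : e ≤ E) (hr : r.IsRunOf (LocalDeltaStep F.nonlin rnd δ p e) F.initState) :
    r.AllEpsFull ((2 : ℝ)⁻¹ ^ (B + E)) := by
  rintro i P α C ⟨hi, hl, L, hS⟩
  have hcontains : (r.state i).Contains (F.lin : Set (LinClause n)) :=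
    hr.invariant Set.Subset.rfl (fun _ _ _ hS h => h.1.contains hS) i hi.le
  have hstep := hr.2 i hi
  rw [hS] at hcontains hstep
  rw [hl] at hstep
  exact hstep.isEpsFullLinearisation hB hrnd he hcontains

theorem KRun.IsRunOf.localDeltaStep (hF : F.IsBoundedInstance)
    (hrel : ∀ P ∈ F.nonlin, P.rel = PredSym.gt ∨ P.rel = PredSym.ge)
    (hp : (2 : ℝ)⁻¹ ^ (p + 2) ≤ δ / 2) (hrnd : IsRounding rnd) (he : 0 < e)
    (hr : r.IsRunOf (LocalProcStep F.nonlin rnd δ p e) F.initState) :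
    r.IsRunOf (LocalDeltaStep F.nonlin rnd δ p e) F.initState :=
  hr.mono_of_invariant (I := KState.Contains (F.lin : Set (LinClause n))) Set.Subset.rfl
    (fun _ _ _ hS h => h.1.contains hS)
    fun _ _ _ hS h => ⟨h.deltaStep hF hrel hp hrnd he hS, h.1⟩

end Procedure

theorem mainTheorem4_general {n : ℕ} (F : SepFormula n) (hF : F.IsBoundedInstance) (p E : ℕ) :
    ∃ ε : ℝ, 0 < ε ∧
      ∀ (δ : ℚ) (rnd : ∀ k : ℕ, (Fin k → ℚ) → (Fin k → ℤ)), IsRounding rnd → ∀ e ≤ E,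
        (∀ r : KRun n, r.IsRunOf (LocalDeltaStep F.nonlin rnd δ p e) F.initState →
          r.IsEpsFull ε ∧ r.AllEpsFull ε) ∧
        (0 < e → (2 : ℝ)⁻¹ ^ (p + 2) ≤ δ / 2 →
          (∀ P ∈ F.nonlin, P.rel = PredSym.gt ∨ P.rel = PredSym.ge) →
          ∀ r : KRun n, r.IsRunOf (LocalProcStep F.nonlin rnd δ p e) F.initState →
            r.IsRunOf (DeltaStep F.nonlin δ) F.initState ∧ r.IsEpsFull ε ∧ r.AllEpsFull ε) := by
  obtain ⟨B, hB⟩ := hF.exists_queryBound (p + 2)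
  refine ⟨(2 : ℝ)⁻¹ ^ (B + E), by positivity, fun δ rnd hrnd e he => ?_⟩
  have hfull (r : KRun n) (hr : r.IsRunOf (LocalDeltaStep F.nonlin rnd δ p e) F.initState) :
      r.IsEpsFull ((2 : ℝ)⁻¹ ^ (B + E)) ∧ r.AllEpsFull ((2 : ℝ)⁻¹ ^ (B + E)) :=
    have hall := hr.allEpsFull hB hrnd he
    ⟨hall.isEpsFull, hall⟩
  refine ⟨hfull, fun hpos hp hrel r hr => ?_⟩
  have hlocal := hr.localDeltaStep hF hrel hp hrnd hpos
  exact ⟨⟨hlocal.1, fun i hi => (hlocal.2 i hi).1⟩, hfull r hlocal⟩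

theorem mainTheorem4 {n : ℕ} (F : SepFormula n) (hF : F.IsBoundedInstance)
    (hrel : ∀ P ∈ F.nonlin, P.rel = PredSym.gt ∨ P.rel = PredSym.ge)
    (δ : ℚ) (hδ : 0 < δ) (p : ℕ) (hp : -⌊Real.logb 2 (min 1 ((δ : ℝ) / 4))⌋ ≤ (p : ℤ)) :
    ∃ ε : ℝ, 0 < ε ∧
      ∀ rnd : ∀ k : ℕ, (Fin k → ℚ) → (Fin k → ℤ), IsRounding rnd →
        (∀ r : KRun n, r.IsRunOf (LocalDeltaStep F.nonlin rnd δ p 0) F.initState →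
          r.IsEpsFull ε ∧ r.AllEpsFull ε) ∧
        (∀ r : KRun n, r.IsRunOf (LocalProcStep F.nonlin rnd δ p 1) F.initState →
          r.IsRunOf (DeltaStep F.nonlin δ) F.initState ∧ r.IsEpsFull ε ∧ r.AllEpsFull ε) := by
  obtain ⟨ε, hε, h⟩ := mainTheorem4_general F hF p 1
  have hp' := two_inv_pow_add_two_le (Rat.cast_pos.2 hδ) hp
  exact ⟨ε, hε, fun rnd hrnd =>
    ⟨(h δ rnd hrnd 0 zero_le_one).1, (h δ rnd hrnd 1 le_rfl).2 one_pos hp' hrel⟩⟩
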